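/- Let $G$ be a finite, simple, connected planar graph with minimum degree $\delta(G)\ge 2$ and girth $g(G)\ge 7$ (the girth of a graph is the length of its shortest cycle, and $\infty$ if it has no cycle). Then $G$ contains at least one of the following configurations: (a) an edge $uv$ with $d(u)=2$ and $d(v)\le 3$; (b) a vertex $v$ with $d(v)\ge 4$ that has a neighbor $u$ with $d(u)\le 3$ such that all of the other $d(v)-1$ neighbors of $v$ have degree exactly $2$. -/

import Mathlib

/-- `S` is a simple polygonal arc in the plane from `a` to `b`: the union of finitely many
nondegenerate straight segments `[p i, p (i + 1)]`, `i < n`, with `p 0 = a` and `p n = b`, where two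
consecutive segments meet only in their common corner and other pairs of segments are disjoint. -/
def IsPolygonalArc (S : Set (ℝ × ℝ)) (a b : ℝ × ℝ) : Prop :=
  ∃ (n : ℕ) (p : ℕ → ℝ × ℝ), 0 < n ∧ p 0 = a ∧ p n = b ∧
    S = (⋃ i ∈ Set.Iio n, segment ℝ (p i) (p (i + 1))) ∧
    (∀ i < n, p i ≠ p (i + 1)) ∧
    (∀ i j, i < j → j < n →
      ∀ x ∈ segment ℝ (p i) (p (i + 1)) ∩ segment ℝ (p j) (p (j + 1)), j = i + 1 ∧ x = p j)

namespace SimpleGraph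

/-- A drawing of the graph `G` in the plane without crossings: distinct vertices are distinct
points, every edge is a simple polygonal arc joining its two ends and passing through no other
vertex, and two distinct edges meet only in common ends. -/
structure PlaneDrawing {V : Type*} (G : SimpleGraph V) where
  /-- the position of a vertex -/
  point : V → ℝ × ℝ
  /-- the arc of an edge (values at pairs that are not edges are irrelevant) -/
  arc : Sym2 V → Set (ℝ × ℝ)
  point_injective : Function.Injective point
  arc_isPolygonalArc : ∀ u v, G.Adj u v → IsPolygonalArc (arc s(u, v)) (point u) (point v)
  mem_of_point_mem_arc : ∀ e ∈ G.edgeSet, ∀ v, point v ∈ arc e → v ∈ e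
  arc_inter_arc : ∀ e ∈ G.edgeSet, ∀ f ∈ G.edgeSet, e ≠ f →
    ∀ x ∈ arc e ∩ arc f, ∃ v, v ∈ e ∧ v ∈ f ∧ x = point v

/-- A graph is planar if it can be drawn in the plane without crossings. -/
def IsPlanar {V : Type*} (G : SimpleGraph V) : Prop :=
  Nonempty G.PlaneDrawing

end SimpleGraph

/-! If both configurations are absent, discharging (`seven_mul_card_le`) gives 7|V| ≤ 5|E|.
Planarity with girth at least 7 gives 7(|E| + 1) ≤ 2|E| + 7|V| (`IsPlanar.girth_mul_le`), a
contradiction.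

The planar bound replaces Euler's formula by linear algebra. Circulations form a space of dimension
at least |E| - |V| + 1. Tracing faces by a permutation of the darts, every circulation is a
combination of face boundaries. A nonzero face boundary contains a cycle in its support, so its face
has at least g darts; there are 2|E| darts in all (`girth_mul_le_of_faces`).

That face boundaries span is the topological input, and it needs no Jordan curve theorem. The
coefficient of a face is, up to sign, the winding number of the circulation around it, defined by
sums of angles under which segments are seen (`SegmentSystem.exists_potential`). Such a sum is
constant along a segment by conservation of flow, and comparing its limits at a corner shows that it
agrees for consecutive darts of a face. -/

namespace SimpleGraph

open Finset

/-! ### Circulations and face counting -/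

/-- A finite acyclic graph with at least one edge has a vertex with exactly one neighbour. -/
lemma IsAcyclic.exists_existsUnique_adj {V : Type*} [Finite V] {G : SimpleGraph V}
    (hG : G.IsAcyclic) {x y : V}
    (hxy : G.Adj x y) : ∃ v, ∃! w, G.Adj v w := by
  classical
  have : Nonempty V := ⟨x⟩
  have := Fintype.ofFinite V
  obtain ⟨u, v, p, hp, hmax⟩ := Walk.exists_isPath_forall_isPath_length_le_length G
  have hlen : 1 ≤ p.length := by
    have := hmax _ _ (Walk.cons hxy Walk.nil) (by simp [hxy.ne])
    simpa using this
  have hnil : ¬ p.Nil := by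
    intro h; rw [← Walk.length_eq_zero_iff] at h; omega
  refine ⟨v, p.penultimate, (p.adj_penultimate hnil).symm, fun w hw => ?_⟩
  by_cases hs : w ∈ p.support
  · exact hG.eq_penultimate_of_adj_end hp hw hs
  · have := hmax _ _ _ (hp.concat hs hw)
    simp at this

variable {V : Type*} [Fintype V] {G : SimpleGraph V} [DecidableRel G.Adj]

open Classical in
/-- The space of real circulations on `G`: antisymmetric functions on darts whose net outflow
vanishes at every vertex. -/
noncomputable def circulation (G : SimpleGraph V) [DecidableRel G.Adj] :
    Submodule ℝ (G.Dart → ℝ) where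
  carrier := {z | (∀ d, z d.symm = -z d) ∧ ∀ v, ∑ d with d.fst = v, z d = 0}
  add_mem' {x y} hx hy := by
    refine ⟨fun d => ?_, fun v => ?_⟩
    · simp only [Pi.add_apply, hx.1, hy.1]; ring
    · simp only [Pi.add_apply, sum_add_distrib, hx.2, hy.2, add_zero]
  zero_mem' := by simp
  smul_mem' c x hx := by
    refine ⟨fun d => ?_, fun v => ?_⟩
    · simp [hx.1]
    · simp only [Pi.smul_apply, ← smul_sum, hx.2, smul_zero]

/-- The support of a nonzero circulation contains a cycle. -/
lemma exists_isCycle_of_mem_circulation {z : G.Dart → ℝ} (hz : z ∈ G.circulation) (h0 : z ≠ 0) :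
    ∃ (v : V) (c : G.Walk v v), c.IsCycle ∧ ∀ e ∈ c.edges, ∃ d : G.Dart, d.edge = e ∧ z d ≠ 0 := by
  classical
  let H : SimpleGraph V :=
    { Adj := fun a b => ∃ h : G.Adj a b, z ⟨(a, b), h⟩ ≠ 0
      symm := ⟨fun a b ⟨h, hn⟩ => ⟨h.symm, by
        have := hz.1 ⟨(a, b), h⟩
        rw [Dart.symm_mk] at this
        simp only [Prod.swap] at this
        rw [this]
        simpa using hn⟩⟩
      loopless := ⟨fun a ⟨h, _⟩ => G.loopless.irrefl a h⟩ }
  have hle : H ≤ G := fun a b h => h.1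
  -- If the support were a forest, the outflow at a leaf would be a single nonzero value.
  have hnac : ¬ H.IsAcyclic := by
    intro hac
    obtain ⟨d, hd⟩ := Function.ne_iff.mp h0
    obtain ⟨v, w, ⟨hvw, hne⟩, huniq⟩ :=
      hac.exists_existsUnique_adj (x := d.fst) (y := d.snd) ⟨d.adj, hd⟩
    have hsum := hz.2 v
    rw [sum_eq_single_of_mem (⟨(v, w), hvw⟩ : G.Dart) (by simp)] at hsum
    · exact hne hsum
    · rintro ⟨⟨a, b⟩, hab⟩ hm hdne
      simp only [mem_filter, mem_univ, true_and] at hm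
      subst hm
      by_contra hcon
      obtain rfl := huniq b ⟨hab, hcon⟩
      exact hdne rfl
  simp only [IsAcyclic, not_forall, not_not] at hnac
  obtain ⟨v, c, hc⟩ := hnac
  refine ⟨v, c.mapLe hle, hc.mapLe hle, fun e he => ?_⟩
  rw [Walk.edges_mapLe_eq_edges] at he
  have := c.edges_subset_edgeSet he
  induction e with
  | _ a b => exact ⟨⟨(a, b), this.1⟩, rfl, this.2⟩

/-- Rank-nullity on the 2|E|-dimensional space of dart functions: edge sums and vertex outflows have
the same total, so their joint range lies in a hyperplane and has dimension at most |E| + |V| - 1.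
-/
lemma card_edgeFinset_add_one_le [Nonempty V] :
    #G.edgeFinset + 1 ≤ Module.finrank ℝ G.circulation + Fintype.card V := by
  classical
  let f : (G.Dart → ℝ) →ₗ[ℝ] (G.edgeFinset → ℝ) × (V → ℝ) :=
    { toFun := fun z => (fun e => ∑ d with d.edge = e.1, z d, fun v => ∑ d with d.fst = v, z d)
      map_add' := fun x y => by ext <;> simp [sum_add_distrib]
      map_smul' := fun c x => by ext <;> simp [mul_sum] }
  let g : (G.edgeFinset → ℝ) × (V → ℝ) →ₗ[ℝ] ℝ :=
    { toFun := fun p => ∑ v, p.2 v - ∑ e, p.1 e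
      map_add' := fun x y => by simp [sum_add_distrib]; ring
      map_smul' := fun c x => by simp [mul_sum, mul_sub] }
  have hker : LinearMap.ker f ≤ G.circulation := by
    intro z hz
    rw [LinearMap.mem_ker] at hz
    have h1 := congrArg Prod.fst hz
    have h2 := congrArg Prod.snd hz
    refine ⟨fun d => ?_, fun v => congrFun h2 v⟩
    have h3 := congrFun h1 ⟨d.edge, by simp⟩
    simp only [f, LinearMap.coe_mk, AddHom.coe_mk, Dart.edge_fiber, Prod.fst_zero,
      Pi.zero_apply] at h3
    rw [sum_pair d.symm_ne.symm] at h3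
    linarith
  have hrange : LinearMap.range f ≤ LinearMap.ker g := by
    rintro _ ⟨z, rfl⟩
    rw [LinearMap.mem_ker]
    simp only [f, g, LinearMap.coe_mk, AddHom.coe_mk]
    have h1 : ∑ v, ∑ d : G.Dart with d.fst = v, z d = ∑ d, z d :=
      sum_fiberwise univ (fun d : G.Dart => d.fst) z
    have h2 : ∑ e ∈ G.edgeFinset, ∑ d : G.Dart with d.edge = e, z d = ∑ d, z d :=
      sum_fiberwise_of_maps_to (fun d _ => by simp) z
    rw [h1, Finset.sum_coe_sort G.edgeFinset
      (fun e => ∑ d : G.Dart with d.edge = e, z d), h2, sub_self]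
  have hg : LinearMap.range g = ⊤ := by
    rw [LinearMap.range_eq_top]
    intro r
    obtain ⟨v⟩ := ‹Nonempty V›
    exact ⟨(0, Pi.single v r), by simp [g]⟩
  have e1 := f.finrank_range_add_finrank_ker
  have e2 := g.finrank_range_add_finrank_ker
  rw [hg, finrank_top] at e2
  have e3 := Submodule.finrank_mono hker
  have e4 := Submodule.finrank_mono hrange
  have e5 := G.dart_card_eq_twice_card_edges
  simp only [Module.finrank_prod, Module.finrank_fintype_fun_eq_card, Module.finrank_self,
    Fintype.card_coe] at e1 e2
  omega

/-- A rotation-system form of Euler's formula together with face counting: if every circulation is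
the difference of a potential that is constant on the orbits of `φ` ("faces"), then the graph has
few edges. -/
theorem girth_mul_le_of_faces [Nonempty V] (φ : Equiv.Perm G.Dart)
    (hφ : ∀ d, (φ d).fst = d.snd)
    (hw : ∀ z ∈ G.circulation, ∃ w : G.Dart → ℝ,
      (∀ d, w (φ d) = w d) ∧ ∀ d, w d - w d.symm = z d)
    {g : ℕ} (hg : g ≤ G.egirth) :
    g * (#G.edgeFinset + 1) ≤ 2 * #G.edgeFinset + g * Fintype.card V := by
  classical
  let F := Quotient (Equiv.Perm.SameCycle.setoid φ)
  let mk : G.Dart → F := Quotient.mk _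
  have hmk : ∀ d, mk (φ d) = mk d := fun d =>
    Quotient.sound (show φ.SameCycle (φ d) d from ⟨-1, by simp⟩)
  have : Fintype F := Fintype.ofFinite F
  -- The boundary of the face `o`. It is conserved because `φ` matches the darts of `o` entering a
  -- vertex with those leaving it.
  let c : F → G.Dart → ℝ := fun o d => (if mk d = o then 1 else 0) - if mk d.symm = o then 1 else 0
  have hc : ∀ o, c o ∈ G.circulation := by
    refine fun o => ⟨fun d => by simp [c], fun v => ?_⟩
    simp only [c, sum_sub_distrib, sub_eq_zero]
    rw [sum_filter, sum_filter]
    trans ∑ d : G.Dart, if d.snd = v then (if mk d = o then (1 : ℝ) else 0) else 0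
    · rw [← Equiv.sum_comp φ]
      simp only [hφ, hmk]
    · rw [← Equiv.sum_comp (Function.Involutive.toPerm _ (Dart.symm_involutive (G := G)))]
      rfl
  -- Faces with zero boundary, such as the one face of a drawn tree, need not have `g` darts;
  -- dropping them does not change the span.
  let F' := {o : F // c o ≠ 0}
  have hspan : G.circulation ≤ Submodule.span ℝ (Set.range fun o : F' => c o) := by
    intro z hz
    obtain ⟨w, hw1, hw2⟩ := hw z hz
    have hconst : ∀ n : ℕ, ∀ d, w ((φ ^ n) d) = w d := by
      intro n
      induction n with
      | zero => simp
      | succ n ih => intro d; rw [pow_succ', Equiv.Perm.mul_apply, hw1, ih]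
    let W : F → ℝ := Quotient.lift w (fun a b hab => by
      obtain ⟨n, hn⟩ := (show φ.SameCycle a b from hab).exists_nat_pow_eq
      rw [← hn, hconst])
    have hW : ∀ d, W (mk d) = w d := fun _ => rfl
    have hif : ∀ a : F, ∑ o, (if a = o then W o else 0) = W a := fun a =>
      (sum_ite_eq univ a W).trans (if_pos (mem_univ a))
    have hz' : z = ∑ o, W o • c o := by
      ext d
      rw [← hw2 d]
      simp only [c, Finset.sum_apply, Pi.smul_apply, smul_eq_mul, mul_sub, sum_sub_distrib, mul_ite,
        mul_one, mul_zero]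
      rw [hif, hif, hW, hW]
    rw [hz']
    refine Submodule.sum_mem _ fun o _ => Submodule.smul_mem _ _ ?_
    by_cases h : c o = 0
    · rw [h]; exact Submodule.zero_mem _
    · exact Submodule.subset_span ⟨⟨o, h⟩, rfl⟩
  have hdim : Module.finrank ℝ G.circulation ≤ Fintype.card F' :=
    (Submodule.finrank_mono hspan).trans (finrank_range_le_card _)
  have hsize : ∀ o : F, c o ≠ 0 → g ≤ #{d : G.Dart | mk d = o} := by
    intro o ho
    obtain ⟨v, p, hp, hsupp⟩ := exists_isCycle_of_mem_circulation (hc o) ho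
    have h1 : g ≤ p.length := by exact_mod_cast le_egirth.mp hg v p hp
    rw [← p.length_edges, ← List.toFinset_card_of_nodup hp.edges_nodup] at h1
    refine h1.trans (le_trans (card_le_card ?_)
      (card_image_le (f := Dart.edge) (s := {d : G.Dart | mk d = o})))
    intro e he
    obtain ⟨d, rfl, hd⟩ := hsupp e (by simpa using he)
    simp only [mem_image, mem_filter, mem_univ, true_and]
    by_cases h : mk d = o
    · exact ⟨d, h, rfl⟩
    · refine ⟨d.symm, ?_, d.edge_symm⟩
      by_contra h'
      simp [c, h, h'] at hd
  have htotal : g * Fintype.card F' ≤ 2 * #G.edgeFinset := by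
    rw [← G.dart_card_eq_twice_card_edges, ← card_univ (α := G.Dart),
      card_eq_sum_card_fiberwise (f := mk) (t := univ) (fun _ _ => by simp), Fintype.card_subtype,
      mul_comm, ← smul_eq_mul, ← sum_const]
    refine (sum_le_sum fun o ho => hsize o (by simpa using ho)).trans ?_
    exact sum_le_sum_of_subset (subset_univ _)
  have h1 := Nat.mul_le_mul_left g (card_edgeFinset_add_one_le (G := G))
  have h2 := Nat.mul_le_mul_left g hdim
  rw [Nat.mul_add g (Module.finrank _ _)] at h1
  omega

end SimpleGraph

/-! ### The angle under which a segment is seen -/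

open Complex in
-- A quotient equal to `-r` with `r ≥ 0` would make `x` the convex combination of `p` and `q` with
-- weights `r / (1 + r)` and `1 / (1 + r)`. Hence `arg` of the quotient is smooth in `x` off the
-- segment.
lemma Complex.div_sub_mem_slitPlane {p q x : ℂ} (h : x ∉ segment ℝ p q) :
    (q - x) / (p - x) ∈ slitPlane := by
  by_contra hn
  have hp : p - x ≠ 0 := by
    intro h0
    rw [sub_eq_zero] at h0
    exact h (h0 ▸ left_mem_segment ℝ p q)
  rw [mem_slitPlane_iff] at hn
  push Not at hn
  obtain ⟨hre, him⟩ := hn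
  set r : ℝ := -((q - x) / (p - x)).re with hr
  have hr0 : 0 ≤ r := by linarith
  have heq : (q - x) / (p - x) = ((-r : ℝ) : ℂ) := by
    apply Complex.ext <;> simp [hr, him]
  rw [div_eq_iff hp] at heq
  apply h
  have hr1 : 0 < 1 + r := by linarith
  refine ⟨r / (1 + r), 1 / (1 + r), by positivity, by positivity, by field_simp; ring, ?_⟩
  have hr1' : (1 + (r : ℂ)) ≠ 0 := by exact_mod_cast hr1.ne'
  simp only [real_smul]
  push_cast at heq ⊢
  field_simp
  linear_combination heq

open Complex in
/-- The rate of change of the angle under which a segment is seen from a moving point. -/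
lemma Complex.hasDerivAt_arg_div_sub {a b p u : ℂ} {t : ℝ} (h : p + t * u ∉ segment ℝ a b) :
    HasDerivAt (fun t : ℝ => arg ((b - (p + t * u)) / (a - (p + t * u))))
      ((u / (a - (p + t * u))).im - (u / (b - (p + t * u))).im) t := by
  have ha : a - (p + t * u) ≠ 0 := by
    intro h0
    rw [sub_eq_zero] at h0
    exact h (h0 ▸ left_mem_segment ℝ a b)
  have hb : b - (p + t * u) ≠ 0 := by
    intro h0
    rw [sub_eq_zero] at h0
    exact h (h0 ▸ right_mem_segment ℝ a b)
  have hx : HasDerivAt (fun t : ℝ => p + t * u) u t := by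
    simpa using ((hasDerivAt_id t).ofReal_comp.mul_const u).const_add p
  have hlog := ((hx.const_sub b).div (hx.const_sub a) ha).clog_real (div_sub_mem_slitPlane h)
  have him := imCLM.hasFDerivAt.comp_hasDerivAt t hlog
  have hfun : (imCLM ∘ fun t : ℝ => log (((fun x : ℝ => b - (p + x * u)) /
      fun x : ℝ => a - (p + x * u)) t)) =
      fun t : ℝ => arg ((b - (p + t * u)) / (a - (p + t * u))) := by
    ext s
    simp [log_im]
  rw [hfun] at him
  refine him.congr_deriv ?_
  rw [imCLM_apply, ← sub_im]
  congr 1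
  simp only [Pi.div_apply]
  generalize a - (p + t * u) = A at *
  generalize b - (p + t * u) = B at *
  field_simp
  ring

/-! ### Noncrossing segments and their cyclic order around a point -/

/-- A family of oriented segments in the plane, closed under reversal by `inv`, of which two
different ones meet at most in common ends. `pt d` is the start of `d`. -/
structure SegmentSystem (D : Type*) where
  pt : D → ℂ
  inv : D → D
  inv_inv : ∀ d, inv (inv d) = d
  pt_inv_ne : ∀ d, pt (inv d) ≠ pt d
  eq_of_mem : ∀ d e, e ≠ d → e ≠ inv d → ∀ x ∈ segment ℝ (pt d) (pt (inv d)),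
    x ∈ segment ℝ (pt e) (pt (inv e)) → (x = pt d ∨ x = pt (inv d)) ∧ (x = pt e ∨ x = pt (inv e))

namespace SegmentSystem

open Complex Finset Filter Topology

variable {D : Type*} (S : SegmentSystem D)

/-- The direction vector of a segment. -/
def dir (d : D) : ℂ := S.pt (S.inv d) - S.pt d

lemma dir_ne_zero (d : D) : S.dir d ≠ 0 := sub_ne_zero.mpr (S.pt_inv_ne d)

lemma dir_inv (d : D) : S.dir (S.inv d) = -S.dir d := by simp [dir, S.inv_inv]

lemma add_mul_dir_mem_segment (d : D) {t : ℝ} (h0 : 0 ≤ t) (h1 : t ≤ 1) :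
    S.pt d + t * S.dir d ∈ segment ℝ (S.pt d) (S.pt (S.inv d)) := by
  refine ⟨1 - t, t, by linarith, h0, by ring, ?_⟩
  simp only [real_smul, dir]
  push_cast
  ring

lemma add_mul_dir_ne_pt (d : D) {t : ℝ} (h0 : t ≠ 0) : S.pt d + t * S.dir d ≠ S.pt d := by
  simp [h0, S.dir_ne_zero]

lemma add_mul_dir_ne_pt_inv (d : D) {t : ℝ} (h1 : t ≠ 1) :
    S.pt d + t * S.dir d ≠ S.pt (S.inv d) := by
  intro h
  have : ((t - 1 : ℝ) : ℂ) * S.dir d = 0 := by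
    rw [dir] at *
    push_cast
    linear_combination h
  rcases mul_eq_zero.mp this with h | h
  · exact h1 (by rw [ofReal_eq_zero] at h; linarith)
  · exact S.dir_ne_zero d h

lemma add_mul_dir_notMem_segment {d e : D} (h1 : e ≠ d) (h2 : e ≠ S.inv d) {t : ℝ} (h0 : 0 < t)
    (h1' : t < 1) : S.pt d + t * S.dir d ∉ segment ℝ (S.pt e) (S.pt (S.inv e)) := fun h =>
  ((S.eq_of_mem d e h1 h2 _ (S.add_mul_dir_mem_segment d h0.le h1'.le) h).1).elim
    (S.add_mul_dir_ne_pt d h0.ne') (S.add_mul_dir_ne_pt_inv d h1'.ne)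

/-- Segments leaving a point in the same direction would overlap: the parameter `min 1 r / 2` on `d`
gives an interior point of `d` that also lies on `e`. -/
lemma dir_ne_real_mul_dir {d e : D} (hne : e ≠ d) (hpt : S.pt e = S.pt d) {r : ℝ} (hr : 0 < r) :
    S.dir e ≠ r * S.dir d := by
  intro h
  have h2 : e ≠ S.inv d := fun h => S.pt_inv_ne d (h ▸ hpt)
  have hm : 0 < min 1 r := lt_min one_pos hr
  have hm1 : min 1 r ≤ 1 := min_le_left _ _
  refine S.add_mul_dir_notMem_segment hne h2 (t := min 1 r / 2) (by linarith) (by linarith) ?_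
  have := S.add_mul_dir_mem_segment e (t := min 1 r / 2 / r) (by positivity)
    (by rw [div_le_one hr]; linarith [min_le_right 1 r])
  convert this using 1
  have hr' : (r : ℂ) ≠ 0 := by exact_mod_cast hr.ne'
  rw [h, hpt]
  push_cast
  field_simp

lemma neg_dir_div_mem_slitPlane {d e : D} (hne : e ≠ d) (hpt : S.pt e = S.pt d) :
    -(S.dir e / S.dir d) ∈ slitPlane := by
  by_contra hn
  rw [mem_slitPlane_iff] at hn
  push Not at hn
  obtain ⟨hre, him⟩ := hn
  simp only [neg_re, neg_im, neg_eq_zero] at hre him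
  have heq : S.dir e / S.dir d = (((S.dir e / S.dir d).re : ℝ) : ℂ) := by
    apply Complex.ext <;> simp [him]
  have hpos : 0 < (S.dir e / S.dir d).re := by
    refine lt_of_le_of_ne (by linarith) fun h0 => ?_
    rw [← h0, ofReal_zero] at heq
    exact div_ne_zero (S.dir_ne_zero e) (S.dir_ne_zero d) heq
  rw [div_eq_iff (S.dir_ne_zero d)] at heq
  exact S.dir_ne_real_mul_dir hne hpt hpos heq

/-- The counterclockwise angle from `e` to `d`, in `(0, 2π]`. -/
noncomputable def angle (e d : D) : ℝ := arg (-(S.dir d / S.dir e)) + Real.pi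

lemma angle_pos (e d : D) : 0 < S.angle e d := by
  have := neg_pi_lt_arg (-(S.dir d / S.dir e))
  rw [angle]; linarith

/-- The value 2π instead of 0 makes `e` the last candidate for its own successor. -/
lemma angle_self (e : D) : S.angle e e = 2 * Real.pi := by
  rw [angle, div_self (S.dir_ne_zero e), arg_neg_one]; ring

lemma angle_lt {e d : D} (hne : d ≠ e) (hpt : S.pt d = S.pt e) : S.angle e d < 2 * Real.pi := by
  have h1 := (mem_slitPlane_iff_arg.mp (S.neg_dir_div_mem_slitPlane hne hpt)).1
  have h2 := lt_of_le_of_ne (arg_le_pi _) h1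
  rw [angle]; linarith

lemma coe_angle (e d : D) : (S.angle e d : Real.Angle) = arg (S.dir d) - arg (S.dir e) := by
  have h := div_ne_zero (S.dir_ne_zero d) (S.dir_ne_zero e)
  rw [angle, Real.Angle.coe_add, arg_neg_coe_angle h,
    arg_div_coe_angle (S.dir_ne_zero d) (S.dir_ne_zero e), add_assoc, ← Real.Angle.coe_add,
    ← two_mul, Real.Angle.coe_two_pi, add_zero]

open Classical in
/-- The counterclockwise angle from `e` to `d`, in `[0, 2π)`. -/
noncomputable def angleZero (e d : D) : ℝ := if d = e then 0 else S.angle e d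

/-- Both sides agree modulo 2π and lie in `[0, 2π)`. -/
lemma angle_sub_angle {e f d : D} (hf : S.pt f = S.pt e)
    (hd : S.pt d = S.pt e) (hle : S.angle e f ≤ S.angle e d) :
    S.angle e d - S.angle e f = S.angleZero f d := by
  have hd2 : S.angle e d ≤ 2 * Real.pi := by
    by_cases h : d = e
    · rw [h, S.angle_self]
    · exact (S.angle_lt h hd).le
  have hf0 := S.angle_pos e f
  have key : ((S.angle e d - S.angle e f : ℝ) : Real.Angle) = (S.angleZero f d : ℝ) := by
    rw [Real.Angle.coe_sub, coe_angle, coe_angle, angleZero]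
    split_ifs with h
    · rw [h]; simp
    · rw [coe_angle]; abel
  rw [Real.Angle.angle_eq_iff_two_pi_dvd_sub] at key
  obtain ⟨k, hk⟩ := key
  have hpi := Real.pi_pos
  have h0 : 0 ≤ S.angleZero f d ∧ S.angleZero f d < 2 * Real.pi := by
    rw [angleZero]
    split_ifs with h
    · exact ⟨le_rfl, by positivity⟩
    · exact ⟨(S.angle_pos f d).le, S.angle_lt h (hd.trans hf.symm)⟩
  have hk1 : (k : ℝ) < 1 := by
    by_contra hcon
    push Not at hcon
    nlinarith
  have hk2 : (-1 : ℝ) < k := by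
    by_contra hcon
    push Not at hcon
    nlinarith
  have hk0 : k = 0 := by
    have h1 : k < 1 := by exact_mod_cast hk1
    have h2 : -1 < k := by exact_mod_cast hk2
    omega
  rw [hk0] at hk
  simp at hk
  linarith

variable [Fintype D]

lemma exists_next (e : D) : ∃ f, S.pt f = S.pt e ∧ ∀ d, S.pt d = S.pt e →
    S.angle e f ≤ S.angle e d := by
  classical
  obtain ⟨f, hf, hmin⟩ := exists_min_image {d | S.pt d = S.pt e} (S.angle e) ⟨e, by simp⟩
  exact ⟨f, by simpa using hf, fun d hd => hmin d (by simpa using hd)⟩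

/-- The next segment in counterclockwise order among those with the same start. -/
noncomputable def next (e : D) : D := (S.exists_next e).choose

lemma pt_next (e : D) : S.pt (S.next e) = S.pt e := (S.exists_next e).choose_spec.1

lemma angle_next_le {e d : D} (hd : S.pt d = S.pt e) : S.angle e (S.next e) ≤ S.angle e d :=
  (S.exists_next e).choose_spec.2 d hd

lemma angle_sub_angle_next {e d : D} (hd : S.pt d = S.pt e) :
    S.angle e d - S.angle e (S.next e) = S.angleZero (S.next e) d :=
  S.angle_sub_angle (S.pt_next e) hd (S.angle_next_le hd)

lemma next_ne {e d : D} (hne : d ≠ e) (hd : S.pt d = S.pt e) : S.next e ≠ e := by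
  intro h
  have h1 := S.angle_next_le hd
  rw [h, S.angle_self] at h1
  exact absurd (S.angle_lt hne hd) (not_lt.mpr h1)

/-- Counted counterclockwise from a common successor, `e` would come strictly after `f` and `f`
strictly after `e`. -/
lemma next_injective : Function.Injective S.next := by
  intro e f h
  by_contra hne
  have hpt : S.pt e = S.pt f := by rw [← S.pt_next e, h, S.pt_next]
  have h1 := S.angle_sub_angle_next (e := e) rfl
  have h2 := S.angle_sub_angle_next hpt.symm
  have h3 := S.angle_sub_angle_next (e := f) rfl
  have h4 := S.angle_sub_angle_next hpt
  rw [h] at h1 h2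
  rw [S.angle_self] at h1 h3
  have h5 := S.angle_lt (Ne.symm hne) hpt.symm
  have h6 := S.angle_lt hne hpt
  linarith

end SegmentSystem

/-! ### Winding numbers as potentials -/

namespace SegmentSystem

open Complex Finset Filter Topology

variable {D : Type*} (S : SegmentSystem D)

lemma tendsto_arg_of_notMem {d e : D} (h1 : e ≠ d) (h2 : e ≠ S.inv d) (h3 : S.pt e ≠ S.pt d)
    (h4 : S.pt (S.inv e) ≠ S.pt d) :
    Tendsto (fun t : ℝ => arg ((S.pt (S.inv e) - (S.pt d + t * S.dir d)) /
      (S.pt e - (S.pt d + t * S.dir d)))) (𝓝[>] 0)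
      (𝓝 (arg ((S.pt (S.inv e) - S.pt d) / (S.pt e - S.pt d)))) := by
  have hm : S.pt d + (0 : ℝ) * S.dir d ∉ segment ℝ (S.pt e) (S.pt (S.inv e)) := by
    intro h
    have := (S.eq_of_mem d e h1 h2 _ (S.add_mul_dir_mem_segment d le_rfl zero_le_one) h).2
    simp only [ofReal_zero, zero_mul, add_zero] at this
    exact this.elim h3.symm h4.symm
  have := (hasDerivAt_arg_div_sub hm).continuousAt.tendsto
  simp only [ofReal_zero, zero_mul, add_zero] at this
  exact this.mono_left nhdsWithin_le_nhds

/-- Multiplying the quotient by `t > 0` keeps its argument and turns it into `t - dir e / dir d`,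
whose limit avoids the cut of `arg`. -/
lemma tendsto_arg_of_pt_eq {d e : D} (h1 : e ≠ d) (h3 : S.pt e = S.pt d) :
    Tendsto (fun t : ℝ => arg ((S.pt (S.inv e) - (S.pt d + t * S.dir d)) /
      (S.pt e - (S.pt d + t * S.dir d)))) (𝓝[>] 0)
      (𝓝 (arg (-(S.dir e / S.dir d)))) := by
  have hd := S.dir_ne_zero d
  have h := continuousAt_arg (S.neg_dir_div_mem_slitPlane h1 h3)
  have hlim : Tendsto (fun t : ℝ => -(S.dir e / S.dir d) + t) (𝓝[>] 0)
      (𝓝 (-(S.dir e / S.dir d))) := by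
    have : Tendsto (fun t : ℝ => -(S.dir e / S.dir d) + t) (𝓝 0)
        (𝓝 (-(S.dir e / S.dir d) + (0 : ℝ))) :=
      (Continuous.tendsto (by fun_prop) 0)
    rw [ofReal_zero, add_zero] at this
    exact this.mono_left nhdsWithin_le_nhds
  refine (h.tendsto.comp hlim).congr' ?_
  filter_upwards [self_mem_nhdsWithin] with t ht
  have ht' : (0 : ℝ) < t := ht
  have htc : (t : ℂ) ≠ 0 := by exact_mod_cast ht'.ne'
  rw [Function.comp_apply, ← arg_real_mul _ (inv_pos.mpr ht')]
  congr 1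
  rw [h3, sub_add_cancel_left]
  push_cast
  have : S.pt (S.inv e) = S.dir e + S.pt d := by rw [dir, h3]; ring
  rw [this]
  field_simp
  ring

lemma arg_swap {p q x : ℂ} (h : x ∉ segment ℝ p q) :
    arg ((p - x) / (q - x)) = -arg ((q - x) / (p - x)) := by
  rw [← inv_div, arg_inv, if_neg (mem_slitPlane_iff_arg.mp (div_sub_mem_slitPlane h)).1]

variable [Fintype D]

lemma sum_mul_comp_pt_eq_zero {z : D → ℝ} (h : ∀ p, (∑ d with S.pt d = p, z d) = 0)
    (f : ℂ → ℝ) : ∑ d, z d * f (S.pt d) = 0 := by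
  classical
  rw [← sum_fiberwise_of_maps_to (t := univ.image S.pt) (g := S.pt) (by simp)]
  refine sum_eq_zero fun p _ => ?_
  rw [sum_congr rfl (g := fun d => z d * f p), ← sum_mul]
  · convert zero_mul _
    exact h p
  · intro d hd
    rw [(mem_filter.mp hd).2]

open Classical in
/-- The total angle, weighted by `z`, under which all segments other than `d` and its reverse are
seen from the point of `d` with parameter `t`. -/
noncomputable def view (z : D → ℝ) (d : D) (t : ℝ) : ℝ :=
  ∑ e with e ≠ d ∧ e ≠ S.inv d, z e * arg ((S.pt (S.inv e) - (S.pt d + t * S.dir d)) /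
    (S.pt e - (S.pt d + t * S.dir d)))

lemma sum_comp_inv (f : D → ℝ) : ∑ e, f (S.inv e) = ∑ e, f e :=
  Equiv.sum_comp (Function.Involutive.toPerm S.inv S.inv_inv) f

/-- Each term has derivative `z e` times a difference of values of `f` at the two ends, so the sum
regroups into outflows, which vanish. The omitted `d` and its reverse can be put back because `f` is
zero at both ends of `d`. -/
lemma hasDerivAt_view {z : D → ℝ} (h0 : ∀ d, z (S.inv d) = -z d)
    (h : ∀ p, (∑ d with S.pt d = p, z d) = 0) (d : D) {t : ℝ} (ht : t ∈ Set.Ioo (0 : ℝ) 1) :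
    HasDerivAt (S.view z d) 0 t := by
  classical
  set f : ℂ → ℝ := fun p => (S.dir d / (p - (S.pt d + t * S.dir d))).im with hf
  have hsum : HasDerivAt (S.view z d)
      (∑ e with e ≠ d ∧ e ≠ S.inv d, z e * (f (S.pt e) - f (S.pt (S.inv e)))) t := by
    refine HasDerivAt.fun_sum fun e he => HasDerivAt.const_mul _ (hasDerivAt_arg_div_sub ?_)
    simp only [mem_filter, mem_univ, true_and] at he
    exact S.add_mul_dir_notMem_segment he.1 he.2 ht.1 ht.2
  convert hsum using 1
  have hd := S.dir_ne_zero d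
  have hf1 : f (S.pt d) = 0 := by
    have : S.dir d / (S.pt d - (S.pt d + t * S.dir d)) = ((-t⁻¹ : ℝ) : ℂ) := by
      have : (t : ℂ) ≠ 0 := by exact_mod_cast ht.1.ne'
      rw [sub_add_cancel_left]
      push_cast
      field_simp
    rw [hf]; simp only; rw [this, ofReal_im]
  have hf2 : f (S.pt (S.inv d)) = 0 := by
    have : S.dir d / (S.pt (S.inv d) - (S.pt d + t * S.dir d)) = (((1 - t)⁻¹ : ℝ) : ℂ) := by
      have h1 : ((1 - t : ℝ) : ℂ) ≠ 0 := by exact_mod_cast (sub_pos.mpr ht.2).ne'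
      have h2 : S.pt (S.inv d) - (S.pt d + t * S.dir d) = ((1 - t : ℝ) : ℂ) * S.dir d := by
        rw [dir]; push_cast; ring
      rw [h2]
      rw [ofReal_inv]
      field_simp
    rw [hf]; simp only; rw [this, ofReal_im]
  rw [sum_filter]
  have hall : ∀ e, (if e ≠ d ∧ e ≠ S.inv d then z e * (f (S.pt e) - f (S.pt (S.inv e))) else 0) =
      z e * f (S.pt e) + z (S.inv e) * f (S.pt (S.inv e)) := by
    intro e
    rw [h0]
    split_ifs with hc
    · ring
    · rw [not_and_or, not_not, not_not] at hc
      rcases hc with rfl | rfl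
      · rw [hf1, hf2]; ring
      · rw [S.inv_inv, hf1, hf2]; ring
  rw [sum_congr rfl fun e _ => hall e, sum_add_distrib,
    S.sum_comp_inv fun e => z e * f (S.pt e), S.sum_mul_comp_pt_eq_zero h f, add_zero]

/-- The parameter `1/2` names the same point from either orientation. -/
lemma view_inv (z : D → ℝ) (d : D) : S.view z (S.inv d) 2⁻¹ = S.view z d 2⁻¹ := by
  have : S.pt (S.inv d) + (2⁻¹ : ℝ) * S.dir (S.inv d) = S.pt d + (2⁻¹ : ℝ) * S.dir d := by
    rw [S.dir_inv, dir]; push_cast; ring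
  rw [view, view, this, S.inv_inv]
  congr 1
  ext e
  simp only [mem_filter, mem_univ, true_and]
  tauto

open Classical in
/-- The contribution to `view` at the point `p` of the segments that do not end at `p`. -/
noncomputable def farView (z : D → ℝ) (p : ℂ) : ℝ :=
  ∑ e with S.pt e ≠ p ∧ S.pt (S.inv e) ≠ p,
    z e * arg ((S.pt (S.inv e) - p) / (S.pt e - p))

/-- The view is constant along `d`, so it equals its limit at the start. There a segment `e ≠ d`
contributes `z e * (angle - π)`, twice because of its reverse; by conservation the terms `-π` add up
to `π * z d` before doubling. -/
lemma view_half {z : D → ℝ} (h0 : ∀ d, z (S.inv d) = -z d)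
    (h : ∀ p, (∑ d with S.pt d = p, z d) = 0) (d : D) :
    S.view z d 2⁻¹ = S.farView z (S.pt d) + 2 * Real.pi * z d +
      2 * ∑ e with S.pt e = S.pt d, z e * S.angleZero d e := by
  classical
  obtain ⟨K, hK⟩ := isOpen_Ioo.exists_is_const_of_deriv_eq_zero isPreconnected_Ioo
    (fun t ht => (S.hasDerivAt_view h0 h d ht).differentiableAt.differentiableWithinAt)
    (fun t ht => (S.hasDerivAt_view h0 h d ht).deriv)
  rw [hK 2⁻¹ ⟨by norm_num, by norm_num⟩]
  have hKlim : Tendsto (S.view z d) (𝓝[>] 0) (𝓝 K) :=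
    tendsto_const_nhds.congr' (by
      filter_upwards [Ioo_mem_nhdsGT (zero_lt_one' ℝ)] with t ht using (hK t ht).symm)
  let R : D → ℝ := fun e => if S.pt e = S.pt d ∧ e ≠ d then z e * arg (-(S.dir e / S.dir d)) else 0
  let C : D → ℝ := fun e => if S.pt e ≠ S.pt d ∧ S.pt (S.inv e) ≠ S.pt d then
    z e * arg ((S.pt (S.inv e) - S.pt d) / (S.pt e - S.pt d)) else 0
  have hlim : Tendsto (S.view z d) (𝓝[>] 0)
      (𝓝 (∑ e with e ≠ d ∧ e ≠ S.inv d, (R e + R (S.inv e) + C e))) := by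
    refine tendsto_finsetSum _ fun e he => ?_
    simp only [mem_filter, mem_univ, true_and] at he
    by_cases h3 : S.pt e = S.pt d
    · have h4 : S.pt (S.inv e) ≠ S.pt d := h3 ▸ S.pt_inv_ne e
      simp only [R, C, h3, h4, he.1, true_and, false_and, not_true, ne_eq, not_false_eq_true,
        if_true, if_false, add_zero]
      have := (S.tendsto_arg_of_pt_eq he.1 h3).const_mul (z e)
      rwa [h3] at this
    by_cases h4 : S.pt (S.inv e) = S.pt d
    · have h5 : S.inv e ≠ d := fun hc => he.2 (by rw [← hc, S.inv_inv])
      simp only [R, C, h3, h4, h5, true_and, false_and, and_false, not_true, ne_eq,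
        not_false_eq_true, if_true, if_false, add_zero, zero_add]
      rw [h0, neg_mul, ← mul_neg]
      have := ((S.tendsto_arg_of_pt_eq h5 h4).neg).const_mul (z e)
      refine this.congr' ?_
      filter_upwards [Ioo_mem_nhdsGT (zero_lt_one' ℝ)] with t ht
      have := S.add_mul_dir_notMem_segment he.1 he.2 ht.1 ht.2
      rw [S.inv_inv, ← arg_swap (by rwa [segment_symm]), h4]
    · simp only [R, C, h3, h4, false_and, not_false_eq_true, ne_eq, and_self, if_true, if_false,
        zero_add]
      exact (S.tendsto_arg_of_notMem he.1 he.2 h3 h4).const_mul (z e)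
  rw [tendsto_nhds_unique hKlim hlim, sum_filter]
  have hall : ∀ e, (if e ≠ d ∧ e ≠ S.inv d then R e + R (S.inv e) + C e else 0) =
      R e + R (S.inv e) + C e := by
    intro e
    split_ifs with hc
    · rfl
    · rw [not_and_or, not_not, not_not] at hc
      rcases hc with rfl | rfl
      · simp [R, C, S.pt_inv_ne]
      · simp [R, C, S.pt_inv_ne, S.inv_inv]
  rw [sum_congr rfl fun e _ => hall e, sum_add_distrib, sum_add_distrib, S.sum_comp_inv R]
  have hC : ∑ e, C e = S.farView z (S.pt d) := by
    rw [farView, sum_filter]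
  have hR : ∑ e, R e = Real.pi * z d + ∑ e with S.pt e = S.pt d, z e * S.angleZero d e := by
    have h1 : ∀ e, R e = (if S.pt e = S.pt d then z e * S.angleZero d e else 0) -
        Real.pi * (if S.pt e = S.pt d then z e else 0) +
        if e = d then Real.pi * z e else 0 := by
      intro e
      simp only [R, angleZero, angle]
      by_cases h3 : e = d
      · subst h3; simp
      · by_cases h4 : S.pt e = S.pt d
        · simp [h3, h4]; ring
        · simp [h3, h4]
    rw [sum_congr rfl fun e _ => h1 e, sum_add_distrib, sum_sub_distrib, ← mul_sum, ← sum_filter,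
      ← sum_filter]
    have h2 := h (S.pt d)
    have h2' : (∑ e with S.pt e = S.pt d, z e) = 0 := by convert h2
    rw [h2', sum_ite_eq' univ d]
    simp
    ring
  rw [hC, hR]
  ring

/-- Every circulation on a noncrossing system of segments is the difference of a potential that is
constant along the faces. -/
theorem exists_potential {z : D → ℝ} (h0 : ∀ d, z (S.inv d) = -z d)
    (h : ∀ p, (∑ d with S.pt d = p, z d) = 0) :
    ∃ w : D → ℝ, (∀ d, w (S.next (S.inv d)) = w d) ∧ ∀ d, w d - w (S.inv d) = z d := by
  classical
  have hpi := Real.pi_ne_zero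
  -- This is minus the winding number of `z` around points just to the right of `d`: the view counts
  -- every segment in both orientations, hence the half, and `d` itself is seen from there under the
  -- angle `-π`.
  refine ⟨fun d => -(S.view z d 2⁻¹ / 2 - Real.pi * z d) / (2 * Real.pi), fun d => ?_, fun d => ?_⟩
  · have key : S.view z (S.next (S.inv d)) 2⁻¹ / 2 - Real.pi * z (S.next (S.inv d)) =
        S.view z (S.inv d) 2⁻¹ / 2 + Real.pi * z (S.inv d) := by
      set e := S.inv d
      rw [S.view_half h0 h, S.view_half h0 h, S.pt_next]
      -- Passing from `e` to its successor shifts all angles by a constant, which conservation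
      -- kills, except that `e` itself jumps by a further 2π.
      have h1 : ∀ f, S.pt f = S.pt e → z f * S.angleZero (S.next e) f =
          z f * S.angleZero e f + (if f = e then z f * (2 * Real.pi) else 0) -
            z f * S.angle e (S.next e) := by
        intro f hf
        rw [← S.angle_sub_angle_next hf, angleZero]
        split_ifs with hfe
        · rw [hfe, S.angle_self]; ring
        · ring
      have h2 : (∑ f with S.pt f = S.pt e, z f) = 0 := by convert h (S.pt e)
      have h3 : ∑ f with S.pt f = S.pt e, z f * S.angleZero (S.next e) f =
          ∑ f with S.pt f = S.pt e, z f * S.angleZero e f + z e * (2 * Real.pi) := by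
        rw [sum_congr rfl fun f hf => h1 f (mem_filter.mp hf).2, sum_sub_distrib, sum_add_distrib,
          ← sum_mul, h2, sum_ite_eq', if_pos (by simp)]
        ring
      rw [h3]
      ring
    simp only
    rw [key, S.view_inv, h0]
    ring
  · simp only
    rw [S.view_inv, h0]
    field_simp
    ring

end SegmentSystem

/-! ### From plane drawings to noncrossing segments -/

/-- `p 0, …, p n` are the corners of a simple polygonal path with `n` segments. -/
structure IsSimplePolygon (n : ℕ) (p : ℕ → ℂ) : Prop where
  pos : 0 < n
  ne_succ : ∀ i < n, p i ≠ p (i + 1)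
  eq_of_mem : ∀ i j, i < j → j < n → ∀ x ∈ segment ℝ (p i) (p (i + 1)),
    x ∈ segment ℝ (p j) (p (j + 1)) → j = i + 1 ∧ x = p j

namespace IsSimplePolygon

variable {n : ℕ} {p : ℕ → ℂ} (h : IsSimplePolygon n p)
include h

lemma ne_of_lt {i j : ℕ} (hij : i < j) (hj : j ≤ n) : p i ≠ p j := by
  intro heq
  rcases Nat.lt_or_ge (i + 1) j with h1 | h1
  · obtain ⟨k, rfl⟩ : ∃ k, j = k + 1 := ⟨j - 1, by omega⟩
    obtain ⟨rfl, h3⟩ := h.eq_of_mem i k (by omega) (by omega) (p i) (left_mem_segment ℝ _ _)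
      (heq ▸ right_mem_segment ℝ _ _)
    exact h.ne_succ i (by omega) h3
  · obtain rfl : j = i + 1 := by omega
    exact h.ne_succ i (by omega) heq

lemma eq_of_eq {i j : ℕ} (hi : i ≤ n) (hj : j ≤ n) (heq : p i = p j) : i = j := by
  rcases lt_trichotomy i j with h1 | h1 | h1
  · exact absurd heq (h.ne_of_lt h1 hj)
  · exact h1
  · exact absurd heq.symm (h.ne_of_lt h1 hi)

lemma eq_or_eq_of_corner_mem {i k : ℕ} (hi : i < n) (hk : k ≤ n)
    (hm : p k ∈ segment ℝ (p i) (p (i + 1))) : p k = p i ∨ p k = p (i + 1) := by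
  rcases lt_trichotomy k i with h1 | rfl | h1
  · exact Or.inl (h.eq_of_mem k i h1 hi _ (left_mem_segment ℝ _ _) hm).2
  · exact Or.inl rfl
  · obtain ⟨m, rfl⟩ : ∃ m, k = m + 1 := ⟨k - 1, by omega⟩
    rcases Nat.lt_or_ge i m with h2 | h2
    · have := (h.eq_of_mem i m h2 (by omega) _ hm (right_mem_segment ℝ _ _)).2
      exact absurd this.symm (h.ne_succ m (by omega))
    · obtain rfl : i = m := by omega
      exact Or.inr rfl

lemma reverse : IsSimplePolygon n (fun i => p (n - i)) := by
  refine ⟨h.pos, fun i hi => ?_, fun i j hij hj x hx hx' => ?_⟩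
  · have h1 := h.ne_succ (n - (i + 1)) (by omega)
    rw [show n - (i + 1) + 1 = n - i by omega] at h1
    exact h1.symm
  · have h1 := h.eq_of_mem (n - (j + 1)) (n - (i + 1)) (by omega) (by omega) x
    rw [show n - (j + 1) + 1 = n - j by omega, show n - (i + 1) + 1 = n - i by omega,
      segment_symm, segment_symm ℝ (p (n - (i + 1)))] at h1
    obtain ⟨h2, h3⟩ := h1 hx' hx
    refine ⟨by omega, ?_⟩
    rw [h3]
    congr 1

end IsSimplePolygon

lemma IsPolygonalArc.exists_isSimplePolygon {S : Set (ℝ × ℝ)} {a b : ℝ × ℝ}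
    (h : IsPolygonalArc S a b) : ∃ (n : ℕ) (p : ℕ → ℂ), IsSimplePolygon n p ∧
      p 0 = Complex.equivRealProdCLM.symm a ∧ p n = Complex.equivRealProdCLM.symm b ∧
      ∀ i < n, segment ℝ (p i) (p (i + 1)) ⊆ Complex.equivRealProdCLM.symm '' S := by
  obtain ⟨n, p, hn, h0, h1, rfl, hne, hcross⟩ := h
  set T := Complex.equivRealProdCLM.symm
  have hseg : ∀ i, segment ℝ (T (p i)) (T (p (i + 1))) = T '' segment ℝ (p i) (p (i + 1)) :=
    fun i => (image_segment ℝ (T : ℝ × ℝ →ₗ[ℝ] ℂ).toAffineMap _ _).symm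
  refine ⟨n, fun i => T (p i), ⟨hn, fun i hi h => hne i hi (T.injective h), ?_⟩,
    congrArg T h0, congrArg T h1, fun i hi => ?_⟩
  · intro i j hij hj x hx hx'
    rw [hseg] at hx hx'
    obtain ⟨y, hy, rfl⟩ := hx
    obtain ⟨y', hy', hyy⟩ := hx'
    obtain rfl := T.injective hyy
    obtain ⟨h2, h3⟩ := hcross i j hij hj y' ⟨hy, hy'⟩
    exact ⟨h2, by rw [h3]⟩
  · rw [hseg]
    exact Set.image_mono (Set.subset_biUnion_of_mem (u := fun i => segment ℝ (p i) (p (i + 1)))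
      (show i ∈ Set.Iio n from hi))

namespace SimpleGraph

variable {V : Type*}

/-- A plane drawing in which the corners of every arc are recorded, for both orientations. -/
structure PolygonalDrawing (G : SimpleGraph V) where
  point : V → ℂ
  len : G.Dart → ℕ
  corner : G.Dart → ℕ → ℂ
  len_symm : ∀ d, len d.symm = len d
  corner_symm : ∀ d, ∀ i ≤ len d, corner d.symm i = corner d (len d - i)
  point_injective : Function.Injective point
  isSimplePolygon : ∀ d, IsSimplePolygon (len d) (corner d)
  corner_zero : ∀ d, corner d 0 = point d.fst
  corner_len : ∀ d, corner d (len d) = point d.snd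
  mem_of_point_mem : ∀ d, ∀ i < len d, ∀ v,
    point v ∈ segment ℝ (corner d i) (corner d (i + 1)) → v = d.fst ∨ v = d.snd
  exists_eq_point : ∀ d e, e ≠ d → e ≠ d.symm → ∀ i < len d, ∀ j < len e,
    ∀ x ∈ segment ℝ (corner d i) (corner d (i + 1)),
      x ∈ segment ℝ (corner e j) (corner e (j + 1)) → ∃ v, (v = d.fst ∨ v = d.snd) ∧
        (v = e.fst ∨ v = e.snd) ∧ x = point v

/-- Corner sequences chosen separately for the two darts of an edge need not be reverses of each
other; one representative per edge fixes both. -/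
lemma exists_dart_selection (G : SimpleGraph V) :
    ∃ r : G.Dart → G.Dart, (∀ d, r d.symm = r d) ∧ ∀ d, r d = d ∨ r d = d.symm := by
  have h : ∀ e : G.edgeSet, ∃ d : G.Dart, d.edge = e := by
    rintro ⟨e, he⟩
    induction e with
    | _ a b => exact ⟨⟨(a, b), he⟩, rfl⟩
  choose c hc using h
  refine ⟨fun d => c ⟨d.edge, d.edge_mem⟩, fun d => ?_, fun d => ?_⟩
  · simp only [Dart.edge_symm]
  · rw [← dart_edge_eq_iff, hc]

lemma PlaneDrawing.nonempty_polygonalDrawing {G : SimpleGraph V} (P : G.PlaneDrawing) :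
    Nonempty G.PolygonalDrawing := by
  classical
  set T := Complex.equivRealProdCLM.symm with hT
  have hpoly : ∀ d : G.Dart, ∃ (n : ℕ) (p : ℕ → ℂ), IsSimplePolygon n p ∧
      p 0 = T (P.point d.fst) ∧ p n = T (P.point d.snd) ∧
      ∀ i < n, segment ℝ (p i) (p (i + 1)) ⊆ T '' P.arc d.edge := fun d =>
    (P.arc_isPolygonalArc d.fst d.snd d.adj).exists_isSimplePolygon
  choose n p hsimple hstart hend harc using hpoly
  obtain ⟨r, hr, hr'⟩ := G.exists_dart_selection
  let p' : G.Dart → ℕ → ℂ := fun d i => if r d = d then p (r d) i else p (r d) (n (r d) - i)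
  have hp1 : ∀ d, r d = d → p' d = p d := fun d h => by ext i; simp only [p', if_pos h]; rw [h]
  have hp2 : ∀ d, r d = d.symm → p' d = fun i => p d.symm (n d.symm - i) := fun d h => by
    ext i
    have : r d ≠ d := by rw [h]; exact d.symm_ne
    simp only [p', if_neg this]; rw [h]
  have harc' : ∀ d, ∀ i < n (r d), segment ℝ (p' d i) (p' d (i + 1)) ⊆ T '' P.arc d.edge := by
    intro d i hi
    rcases hr' d with h | h
    · rw [hp1 d h]
      exact harc d i (by rwa [h] at hi)
    · rw [h] at hi
      rw [hp2 d h, segment_symm]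
      have := harc d.symm (n d.symm - (i + 1)) (by omega)
      rw [show n d.symm - (i + 1) + 1 = n d.symm - i by omega, d.edge_symm] at this
      exact this
  refine ⟨fun v => T (P.point v), fun d => n (r d), p', fun d => by simp only [hr], ?_,
    T.injective.comp P.point_injective, ?_, ?_, ?_, ?_, ?_⟩
  · intro d i hi
    rcases hr' d with h | h
    · rw [hp1 d h, hp2 d.symm (by rw [hr, h, Dart.symm_symm]), h, Dart.symm_symm]
    · rw [hp1 d.symm (by rw [hr, h]), hp2 d h, h]
      rw [h] at hi
      simp only
      rw [Nat.sub_sub_self hi]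
  · intro d
    rcases hr' d with h | h
    · rw [hp1 d h, h]; exact hsimple d
    · rw [hp2 d h, h]; exact (hsimple d.symm).reverse
  · intro d
    rcases hr' d with h | h
    · rw [hp1 d h, hstart]
    · rw [hp2 d h]
      exact hend d.symm
  · intro d
    rcases hr' d with h | h
    · rw [hp1 d h, h, hend]
    · rw [hp2 d h, h]
      simp only [Nat.sub_self]
      exact hstart d.symm
  · intro d i hi v hv
    obtain ⟨y, hy, hyv⟩ := harc' d i hi hv
    rw [T.injective hyv] at hy
    simpa [Dart.edge] using P.mem_of_point_mem_arc _ d.edge_mem v hy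
  · intro d e h1 h2 i hi j hj x hx hx'
    obtain ⟨y, hy, rfl⟩ := harc' d i hi hx
    obtain ⟨y', hy', hyy⟩ := harc' e j hj hx'
    obtain rfl := T.injective hyy
    have hne : d.edge ≠ e.edge := by
      rw [Ne, eq_comm, dart_edge_eq_iff]
      exact not_or.mpr ⟨h1, h2⟩
    obtain ⟨v, hv1, hv2, rfl⟩ := P.arc_inter_arc _ d.edge_mem _ e.edge_mem hne y' ⟨hy, hy'⟩
    exact ⟨v, by simpa [Dart.edge] using hv1, by simpa [Dart.edge] using hv2, rfl⟩

namespace PolygonalDrawing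

variable {G : SimpleGraph V} (P : G.PolygonalDrawing)

/-- The oriented segments of a polygonal drawing. -/
abbrev Seg : Type _ := {x : G.Dart × ℕ // x.2 < P.len x.1}

instance [Finite V] : Finite P.Seg :=
  have : Finite G.Dart := Finite.of_injective _ Dart.toProd_injective
  Finite.of_injective (β := Σ d : G.Dart, Fin (P.len d)) (fun x => ⟨x.1.1, x.1.2, x.2⟩) (by
    rintro ⟨⟨d, i⟩, hi⟩ ⟨⟨e, j⟩, hj⟩ h
    simp only [Sigma.mk.injEq] at h
    obtain ⟨rfl, h⟩ := h
    simpa using h)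

/-- The reversal of a segment. -/
def segInv (x : P.Seg) : P.Seg :=
  ⟨(x.1.1.symm, P.len x.1.1 - 1 - x.1.2), by have := x.2; rw [P.len_symm]; omega⟩

lemma segInv_segInv (x : P.Seg) : P.segInv (P.segInv x) = x := by
  obtain ⟨⟨d, i⟩, hi⟩ := x
  simp only at hi
  simp only [segInv, Dart.symm_symm, P.len_symm, Subtype.mk.injEq, Prod.mk.injEq, true_and]
  omega

lemma corner_segInv (x : P.Seg) :
    P.corner (P.segInv x).1.1 (P.segInv x).1.2 = P.corner x.1.1 (x.1.2 + 1) := by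
  obtain ⟨⟨d, i⟩, hi⟩ := x
  simp only at hi
  simp only [segInv]
  rw [P.corner_symm _ _ (by omega)]
  congr 1
  omega

lemma corner_segInv_succ (x : P.Seg) :
    P.corner (P.segInv x).1.1 ((P.segInv x).1.2 + 1) = P.corner x.1.1 x.1.2 := by
  rw [← P.corner_segInv, P.segInv_segInv]

lemma point_eq_corner {d : G.Dart} {v : V} (hv : v = d.fst ∨ v = d.snd) :
    ∃ k, (k = 0 ∨ k = P.len d) ∧ P.point v = P.corner d k := by
  rcases hv with rfl | rfl
  · exact ⟨0, Or.inl rfl, (P.corner_zero d).symm⟩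
  · exact ⟨_, Or.inr rfl, (P.corner_len d).symm⟩

lemma eq_of_mem_of_dart_eq {x y : P.Seg} (hd : y.1.1 = x.1.1) (hne : y ≠ x) {a : ℂ}
    (hx : a ∈ segment ℝ (P.corner x.1.1 x.1.2) (P.corner x.1.1 (x.1.2 + 1)))
    (hy : a ∈ segment ℝ (P.corner y.1.1 y.1.2) (P.corner y.1.1 (y.1.2 + 1))) :
    (a = P.corner x.1.1 x.1.2 ∨ a = P.corner x.1.1 (x.1.2 + 1)) ∧
      (a = P.corner y.1.1 y.1.2 ∨ a = P.corner y.1.1 (y.1.2 + 1)) := by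
  obtain ⟨⟨d, i⟩, hi⟩ := x
  obtain ⟨⟨e, j⟩, hj⟩ := y
  simp only at hi hj hd hx hy ⊢
  subst hd
  rcases lt_trichotomy i j with h | rfl | h
  · obtain ⟨rfl, rfl⟩ := (P.isSimplePolygon e).eq_of_mem i j h hj a hx hy
    exact ⟨Or.inr rfl, Or.inl rfl⟩
  · exact absurd rfl hne
  · obtain ⟨rfl, rfl⟩ := (P.isSimplePolygon e).eq_of_mem j i h hi a hy hx
    exact ⟨Or.inl rfl, Or.inr rfl⟩

/-- The segments of a polygonal drawing form a noncrossing system. -/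
def segmentSystem : SegmentSystem P.Seg where
  pt x := P.corner x.1.1 x.1.2
  inv := P.segInv
  inv_inv := P.segInv_segInv
  pt_inv_ne x := by
    rw [P.corner_segInv]
    exact ((P.isSimplePolygon _).ne_succ _ x.2).symm
  eq_of_mem x y h1 h2 a hx hy := by
    rw [P.corner_segInv] at hx hy ⊢
    rw [P.corner_segInv]
    by_cases hd : y.1.1 = x.1.1
    · exact P.eq_of_mem_of_dart_eq hd h1 hx hy
    by_cases hd' : y.1.1 = x.1.1.symm
    · have h3 : P.segInv y ≠ x := fun h => h2 (by rw [← h, P.segInv_segInv])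
      have h4 : (P.segInv y).1.1 = x.1.1 := by
        simp only [segInv]; rw [hd', Dart.symm_symm]
      have h5 := P.eq_of_mem_of_dart_eq h4 h3 hx (by
        rwa [P.corner_segInv, P.corner_segInv_succ, segment_symm])
      rw [P.corner_segInv, P.corner_segInv_succ] at h5
      exact ⟨h5.1, h5.2.symm⟩
    -- Different edges share only vertices. A vertex is an end corner of each arc, and a corner
    -- lying on a segment of its own path is an end of that segment.
    · obtain ⟨v, hv1, hv2, rfl⟩ := P.exists_eq_point _ _ hd hd' _ x.2 _ y.2 a hx hy
      constructor
      · obtain ⟨k, hk, hvk⟩ := P.point_eq_corner hv1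
        rw [hvk] at hx ⊢
        exact (P.isSimplePolygon _).eq_or_eq_of_corner_mem x.2 (by omega) hx
      · obtain ⟨k, hk, hvk⟩ := P.point_eq_corner hv2
        rw [hvk] at hy ⊢
        exact (P.isSimplePolygon _).eq_or_eq_of_corner_mem y.2 (by omega) hy

end PolygonalDrawing

end SimpleGraph

/-! ### Faces of a drawing -/

namespace SimpleGraph

open Finset

namespace PolygonalDrawing

variable {V : Type*} {G : SimpleGraph V} (P : G.PolygonalDrawing)

/-- The first segment of the arc of a dart. -/
def firstSeg (d : G.Dart) : P.Seg := ⟨(d, 0), (P.isSimplePolygon d).pos⟩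

/-- The last segment of the arc of a dart. -/
def lastSeg (d : G.Dart) : P.Seg :=
  ⟨(d, P.len d - 1), Nat.sub_lt (P.isSimplePolygon d).pos one_pos⟩

lemma segInv_firstSeg (d : G.Dart) : P.segInv (P.firstSeg d) = P.lastSeg d.symm := by
  simp [segInv, firstSeg, lastSeg, P.len_symm]

lemma segInv_lastSeg (d : G.Dart) : P.segInv (P.lastSeg d) = P.firstSeg d.symm := by
  simp [segInv, firstSeg, lastSeg]

/-- A segment starting at a vertex is the first one of its arc. -/
lemma eq_firstSeg_of_corner_eq_point {x : P.Seg} {v : V}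
    (h : P.corner x.1.1 x.1.2 = P.point v) : x = P.firstSeg x.1.1 ∧ x.1.1.fst = v := by
  have hx := x.2
  have hp := P.isSimplePolygon x.1.1
  have hv := P.mem_of_point_mem x.1.1 x.1.2 hx v (h ▸ left_mem_segment ℝ _ _)
  rcases hv with hv | hv
  · rw [hv, ← P.corner_zero] at h
    have := hp.eq_of_eq hx.le (Nat.zero_le _) h
    exact ⟨Subtype.ext (Prod.ext rfl this), hv.symm⟩
  · rw [hv, ← P.corner_len] at h
    have := hp.eq_of_eq hx.le le_rfl h
    omega

/-- Only two segments start at an inner corner of an arc. -/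
lemma eq_or_eq_of_corner_eq {d : G.Dart} {i : ℕ} (hi : i + 1 < P.len d) {x : P.Seg}
    (h : P.corner x.1.1 x.1.2 = P.corner d (i + 1)) :
    x = ⟨(d, i + 1), hi⟩ ∨ x = P.segInv ⟨(d, i), by simp only; omega⟩ := by
  have hx := x.2
  have hp := P.isSimplePolygon d
  by_cases h1 : x.1.1 = d
  · left
    rw [h1] at h hx
    exact Subtype.ext (Prod.ext h1 (hp.eq_of_eq hx.le hi.le h))
  by_cases h2 : x.1.1 = d.symm
  · right
    rw [h2] at h hx
    rw [P.len_symm] at hx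
    rw [P.corner_symm _ _ hx.le] at h
    have h3 := hp.eq_of_eq (Nat.sub_le _ _) hi.le h
    exact Subtype.ext (Prod.ext h2 (by simp only [segInv]; omega))
  · obtain ⟨v, hv, -, hvc⟩ := P.exists_eq_point d _ h1 h2 (i + 1) hi _ hx _
      (left_mem_segment ℝ _ _) (h ▸ left_mem_segment ℝ _ _)
    obtain ⟨k, hk, hvk⟩ := P.point_eq_corner hv
    rw [hvk] at hvc
    have := hp.eq_of_eq hi.le (by omega) hvc
    omega

variable [Fintype V]

noncomputable instance : Fintype P.Seg := Fintype.ofFinite _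

/-- With just two segments starting at an inner corner, the successor of one is the other, so face
tracing runs straight along an arc. -/
lemma next_segInv_of_succ_lt {d : G.Dart} {i : ℕ} (hi : i + 1 < P.len d) :
    P.segmentSystem.next (P.segInv ⟨(d, i), by simp only; omega⟩) = ⟨(d, i + 1), hi⟩ := by
  set x : P.Seg := ⟨(d, i), by simp only; omega⟩ with hx
  have hpt : P.segmentSystem.pt (P.segInv x) = P.corner d (i + 1) := P.corner_segInv x
  refine (P.eq_or_eq_of_corner_eq hi
    ((P.segmentSystem.pt_next (P.segInv x)).trans hpt)).resolve_right ?_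
  refine P.segmentSystem.next_ne (d := ⟨(d, i + 1), hi⟩) ?_ hpt.symm
  intro h
  have := congrArg (fun y : P.Seg => y.1.1) h
  exact d.symm_ne this.symm

lemma next_segInv_lastSeg (d : G.Dart) :
    ∃ e : G.Dart, e.fst = d.snd ∧
      P.segmentSystem.next (P.segInv (P.lastSeg d)) = P.firstSeg e := by
  have h : P.segmentSystem.pt (P.segmentSystem.next (P.segInv (P.lastSeg d))) =
      P.point d.snd := by
    rw [P.segmentSystem.pt_next, segInv_lastSeg]
    exact P.corner_zero d.symm
  obtain ⟨h1, h2⟩ := P.eq_firstSeg_of_corner_eq_point h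
  exact ⟨_, h2, h1⟩

lemma exists_facePerm : ∃ φ : Equiv.Perm G.Dart, ∀ d, (φ d).fst = d.snd ∧
    P.segmentSystem.next (P.segInv (P.lastSeg d)) = P.firstSeg (φ d) := by
  have : Finite G.Dart := Finite.of_injective _ Dart.toProd_injective
  choose f hf1 hf2 using P.next_segInv_lastSeg
  have hinj : Function.Injective f := by
    intro d e h
    have h1 := (hf2 d).trans ((congrArg P.firstSeg h).trans (hf2 e).symm)
    have h2 := congrArg P.segInv (P.segmentSystem.next_injective h1)
    rw [segInv_segInv, segInv_segInv] at h2
    exact congrArg (fun y : P.Seg => y.1.1) h2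
  exact ⟨Equiv.ofBijective f (Finite.injective_iff_bijective.mp hinj), fun d => ⟨hf1 d, hf2 d⟩⟩

variable [DecidableRel G.Adj]

lemma sum_seg_eq_zero {z : G.Dart → ℝ} (hz : z ∈ G.circulation) (a : ℂ) :
    (∑ x : P.Seg with P.segmentSystem.pt x = a, z x.1.1) = 0 := by
  classical
  rw [← sum_filter_add_sum_filter_not _ (fun x : P.Seg => x.1.2 = 0)]
  have h1 : ∑ x ∈ ({x : P.Seg | P.segmentSystem.pt x = a} : Finset P.Seg) with x.1.2 = 0,
      z x.1.1 = 0 := by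
    trans ∑ d : G.Dart with P.point d.fst = a, z d
    · refine sum_nbij' (fun x => x.1.1) P.firstSeg ?_ ?_ ?_ ?_ ?_
      · rintro ⟨⟨d, i⟩, hi⟩ hx
        simp only [mem_filter, mem_univ, true_and] at hx ⊢
        obtain ⟨hx, rfl⟩ := hx
        rw [← hx]
        exact (P.corner_zero d).symm
      · intro d hd
        simp only [mem_filter, mem_univ, true_and] at hd ⊢
        exact ⟨(P.corner_zero d).trans hd, rfl⟩
      · rintro ⟨⟨d, i⟩, hi⟩ hx
        simp only [mem_filter, mem_univ, true_and] at hx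
        obtain ⟨hx, rfl⟩ := hx
        rfl
      · intro d _; rfl
      · intro x _; rfl
    · by_cases ha : ∃ v, P.point v = a
      · obtain ⟨v, rfl⟩ := ha
        simp only [P.point_injective.eq_iff]
        exact hz.2 v
      · refine sum_eq_zero fun d hd => ?_
        exact absurd ⟨_, (mem_filter.mp hd).2⟩ ha
  rw [h1, zero_add]
  have hsymm : ∀ x : P.Seg, P.len x.1.1 - x.1.2 < P.len x.1.1.symm ∨ x.1.2 = 0 := fun x => by
    rw [P.len_symm]; have := x.2; omega
  -- At inner corners, segment `i` of a dart cancels against the segment of the reversed dart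
  -- starting at the same corner. That one has index `len - i`, which is valid only for `i ≠ 0`.
  refine sum_involution (fun x hx => ⟨(x.1.1.symm, P.len x.1.1 - x.1.2),
    (hsymm x).resolve_right (mem_filter.mp hx).2⟩) ?_ ?_ ?_ ?_
  · intro x _
    simp only
    rw [hz.1, add_neg_cancel]
  · intro x _ _ h
    exact x.1.1.symm_ne (congrArg (fun y : P.Seg => y.1.1) h)
  · rintro ⟨⟨d, i⟩, hi⟩ hx
    simp only [mem_filter, mem_univ, true_and] at hx hi ⊢
    refine ⟨?_, by omega⟩
    refine Eq.trans ?_ hx.1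
    simp only [segmentSystem]
    rw [P.corner_symm _ _ (Nat.sub_le _ _), Nat.sub_sub_self hi.le]
  · rintro ⟨⟨d, i⟩, hi⟩ hx
    simp only at hi
    simp only [P.len_symm, Dart.symm_symm, Subtype.mk.injEq, Prod.mk.injEq, true_and]
    omega

/-- Every circulation on a drawn graph is the difference of a potential that is constant along the
faces of the drawing. -/
theorem exists_perm_forall_exists_potential (P : G.PolygonalDrawing) : ∃ φ : Equiv.Perm G.Dart,
    (∀ d, (φ d).fst = d.snd) ∧ ∀ z ∈ G.circulation, ∃ w : G.Dart → ℝ,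
      (∀ d, w (φ d) = w d) ∧ ∀ d, w d - w d.symm = z d := by
  obtain ⟨φ, hφ⟩ := P.exists_facePerm
  refine ⟨φ, fun d => (hφ d).1, fun z hz => ?_⟩
  obtain ⟨w, hw1, hw2⟩ := P.segmentSystem.exists_potential (z := fun x => z x.1.1)
    (fun x => hz.1 x.1.1) (P.sum_seg_eq_zero hz)
  have hstep : ∀ (d : G.Dart) (i : ℕ) (hi : i < P.len d),
      w ⟨(d, i), hi⟩ = w (P.firstSeg d) := by
    intro d i
    induction i with
    | zero => intro _; rfl
    | succ i ih =>
      intro hi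
      rw [← ih (by omega), ← hw1 ⟨(d, i), by simp only; omega⟩]
      exact congrArg w (P.next_segInv_of_succ_lt hi).symm
  refine ⟨fun d => w (P.firstSeg d), fun d => ?_, fun d => ?_⟩
  · simp only
    rw [← (hφ d).2, ← hstep d (P.len d - 1)]
    exact hw1 (P.lastSeg d)
  · have h1 := hw2 (P.firstSeg d)
    have h2 : w (P.segmentSystem.inv (P.firstSeg d)) = w (P.firstSeg d.symm) :=
      (congrArg w (P.segInv_firstSeg d)).trans (hstep d.symm _ _)
    rw [h2] at h1
    exact h1

end PolygonalDrawing

/-! ### The edge bound and discharging -/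

/-- A planar graph of girth at least `g` has few edges. -/
theorem IsPlanar.girth_mul_le {V : Type*} [Fintype V] [Nonempty V] {G : SimpleGraph V}
    [DecidableRel G.Adj] (hG : G.IsPlanar) {g : ℕ} (hg : g ≤ G.egirth) :
    g * (#G.edgeFinset + 1) ≤ 2 * #G.edgeFinset + g * Fintype.card V := by
  obtain ⟨P⟩ := hG
  obtain ⟨P'⟩ := P.nonempty_polygonalDrawing
  obtain ⟨φ, hφ, hw⟩ := P'.exists_perm_forall_exists_potential
  exact girth_mul_le_of_faces φ hφ hw hg

/-- Discharging with initial charge `5 d(v) - 14`, where each vertex of degree two takes `2` from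
each of its neighbours. -/
lemma seven_mul_card_le {V : Type*} [Fintype V] {G : SimpleGraph V} [DecidableRel G.Adj]
    (hmin : ∀ v, 2 ≤ G.degree v)
    (ha : ∀ u v, G.Adj u v → G.degree u = 2 → 4 ≤ G.degree v)
    (hb : ∀ v, 4 ≤ G.degree v → #{w ∈ G.neighborFinset v | G.degree w = 2} + 1 ≤ G.degree v) :
    7 * Fintype.card V ≤ 5 * #G.edgeFinset := by
  classical
  -- Final charges are nonnegative: 10 - 14 + 4 = 0 in degree 2, 15 - 14 = 1 in degree 3, and at
  -- least 5d - 14 - 2(d - 1) = 3(d - 4) in degree d ≥ 4.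
  have hcharge : ∀ v, 14 + 2 * #{w ∈ G.neighborFinset v | G.degree w = 2} ≤
      5 * G.degree v + 2 * (if G.degree v = 2 then G.degree v else 0) := by
    intro v
    have h2 := hmin v
    rcases Nat.lt_or_ge (G.degree v) 4 with h | h
    · have h0 : #{w ∈ G.neighborFinset v | G.degree w = 2} = 0 := by
        rw [card_eq_zero, filter_eq_empty_iff]
        intro w hw hdw
        have := ha w v ((G.mem_neighborFinset v w).mp hw).symm hdw
        omega
      split_ifs <;> omega
    · have := hb v h
      split_ifs <;> omega
  have hdouble : ∑ v, #{w ∈ G.neighborFinset v | G.degree w = 2} =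
      ∑ v, if G.degree v = 2 then G.degree v else 0 := by
    simp only [card_filter]
    simp only [neighborFinset_eq_filter, sum_filter]
    rw [sum_comm]
    refine sum_congr rfl fun w _ => ?_
    split_ifs with h
    · rw [← G.card_neighborFinset_eq_degree w, neighborFinset_eq_filter, card_filter]
      simp only [G.adj_comm w]
    · simp
  have hsum := sum_le_sum fun v (_ : v ∈ univ) => hcharge v
  rw [sum_add_distrib, sum_add_distrib, ← mul_sum, ← mul_sum, ← mul_sum, hdouble,
    G.sum_degrees_eq_twice_card_edges] at hsum
  simp only [sum_const, card_univ, smul_eq_mul] at hsum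
  omega

end SimpleGraph

theorem mainTheorem8 {V : Type*} [Fintype V] (G : SimpleGraph V) [DecidableRel G.Adj]
    (hplanar : G.IsPlanar) (hconn : G.Connected)
    (hmindeg : 2 ≤ G.minDegree) (hgirth : 7 ≤ G.egirth) :
    (∃ u v : V, G.Adj u v ∧ G.degree u = 2 ∧ G.degree v ≤ 3) ∨
    (∃ v : V, 4 ≤ G.degree v ∧
      ∃ u : V, G.Adj v u ∧ G.degree u ≤ 3 ∧
        ∀ w : V, G.Adj v w → w ≠ u → G.degree w = 2) := by
  by_contra hcon
  push Not at hcon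
  obtain ⟨ha, hb⟩ := hcon
  have := hconn.nonempty
  have h1 : 7 * Fintype.card V ≤ 5 * G.edgeFinset.card := by
    refine SimpleGraph.seven_mul_card_le (fun v => hmindeg.trans (G.minDegree_le_degree v))
      (fun u v huv hu => ha u v huv hu) fun v hv => ?_
    -- If all neighbours of `v` had degree 2, any one of them could play `u` in configuration (b).
    by_contra hcard
    have hsub := Finset.filter_subset (fun w => G.degree w = 2) (G.neighborFinset v)
    have heq := Finset.eq_of_subset_of_card_le hsub
      (by rw [G.card_neighborFinset_eq_degree]; omega)
    have hall : ∀ w, G.Adj v w → G.degree w = 2 := fun w hw =>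
      Finset.filter_eq_self.mp heq _ ((G.mem_neighborFinset v w).mpr hw)
    obtain ⟨u, hu⟩ := (G.degree_pos_iff_exists_adj v).mp (by omega)
    obtain ⟨w, hw, -, hw2⟩ := hb v hv u hu (by rw [hall u hu]; omega)
    exact hw2 (hall w hw)
  have h2 := hplanar.girth_mul_le (g := 7) (by exact_mod_cast hgirth)
  omega
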